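/- Let $(F,g_F)$ be a finite-dimensional smooth Riemannian manifold without boundary, let $f\colon F\to(0,\infty)$ be smooth, and let $I=(t_1,t_2)\subseteq\mathbb R$ with $-\infty\le t_1<t_2\le\infty$. Let $M=I\times F$ carry the metric $g=-f^2\,\mathrm dt^2\oplus g_F$ (a standard static space-time). Let $\mathrm{Ric}$ and $\tau$ be the Ricci tensor and scalar curvature of $g$, and let $T$ be the energy-momentum tensor on $M$ defined by Einstein's equation $\mathrm{Ric}-\tfrac12\tau g=8\pi T$. Let $\mathrm{Ric}_{g_F}$ and $\tau_{g_F}$ be the Ricci tensor and scalar curvature of $g_F$, let $H^f_{g_F}$ be the Hessian tensor of $f$ and $\Delta_{g_F}f$ its $g_F$-trace, put $$\mathscr L^*_{g_F}f:=-f\,\mathrm{Ric}_{g_F}-(\Delta_{g_F}f)\,g_F+H^f_{g_F},$$ and let $\mathcal L^*_{g_F}f(v):=\mathscr L^*_{g_F}f(v,v)$ be the associated quadratic form. A tangent vector $w\in TM$ is causal if $w\ne0$ and $g(w,w)\le0$. 1. If $\mathcal L^*_{g_F}f$ is negative (respectively, positive) semi-definite at every point of $F$ and $\tau_{g_F}\ge0$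 (respectively, $\tau_{g_F}\le0$) on $F$, then $T(w,w)\ge0$ (respectively, $T(w,w)\le0$) for every causal vector $w\in TM$. 2. If $\mathcal L^*_{g_F}f\equiv0$, then $8\pi T(w,w)=-\tfrac12\,\tau_{g_F}\,g(w,w)$ for every $w\in TM$ (with $\tau_{g_F}$ evaluated at the projection to $F$ of the base point of $w$). Consequently, in that case, $T(w,w)\ge0$ for every causal vector $w\in TM$ if and only if $\tau_{g_F}\ge0$ on $F$. -/

import Mathlib

open scoped Manifold ContDiff

set_option maxSynthPendingDepth 3

noncomputable section

namespace PseudoRiem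

section Pullback

variable {V W : Type*} [TopologicalSpace V] [AddCommGroup V] [Module ℝ V]
  [TopologicalSpace W] [AddCommGroup W] [Module ℝ W]

/-- The pullback `(u, v) ↦ B(A u, A v)` of a bilinear form under a linear map. -/
def pullback (B : W →L[ℝ] W →L[ℝ] ℝ) (A : V →L[ℝ] W) : V →L[ℝ] V →L[ℝ] ℝ :=
  (ContinuousLinearMap.precomp ℝ A).comp (B.comp A)

theorem pullback_apply (B : W →L[ℝ] W →L[ℝ] ℝ) (A : V →L[ℝ] W) (u v : V) :
    pullback B A u v = B (A u) (A v) := rfl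

end Pullback

/-! ### Local formulas

`G : E → E →L[ℝ] E →L[ℝ] ℝ` is the coordinate expression of a pseudo-Riemannian metric on an open
subset of the finite-dimensional vector space `E`; the formulas are basis-free. -/

section Local

variable {E : Type*} [NormedAddCommGroup E] [NormedSpace ℝ E]

/-- The Koszul expression
`K(u, v, w) = (D_u G)(v, w) + (D_v G)(u, w) - (D_w G)(u, v)` for constant fields `u, v, w`. -/
def koszul (G : E → E →L[ℝ] E →L[ℝ] ℝ) (x : E) : E →L[ℝ] E →L[ℝ] E →L[ℝ] ℝ :=
  fderiv ℝ G x + (fderiv ℝ G x).flip -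
    ((ContinuousLinearMap.flipₗᵢ ℝ E E ℝ).toContinuousLinearEquiv :
      (E →L[ℝ] E →L[ℝ] ℝ) →L[ℝ] (E →L[ℝ] E →L[ℝ] ℝ)).comp (fderiv ℝ G x).flip

theorem koszul_apply (G : E → E →L[ℝ] E →L[ℝ] ℝ) (x u v w : E) :
    koszul G x u v w
      = fderiv ℝ G x u v w + fderiv ℝ G x v u w - fderiv ℝ G x w u v := rfl

/-- The Christoffel symbol of the Levi-Civita connection: `Γ(u, v) = ∇_u v` for constant fields,
that is, `2 G(Γ(u, v), w) = K(u, v, w)` for all `w`. -/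
def christoffel (G : E → E →L[ℝ] E →L[ℝ] ℝ) (x : E) : E →L[ℝ] E →L[ℝ] E :=
  (1 / 2 : ℝ) • (ContinuousLinearMap.compL ℝ E (E →L[ℝ] ℝ) E (G x).inverse).comp (koszul G x)

theorem christoffel_apply (G : E → E →L[ℝ] E →L[ℝ] ℝ) (x u v : E) :
    christoffel G x u v = (1 / 2 : ℝ) • (G x).inverse (koszul G x u v) := rfl

/-- The endomorphism `u ↦ R(u, v) w` of the Riemann curvature operator
`R(u, v) w = ∇_u ∇_v w - ∇_v ∇_u w - ∇_[u, v] w`. -/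
def curvatureEndo (G : E → E →L[ℝ] E →L[ℝ] ℝ) (x v w : E) : E →L[ℝ] E :=
  ((fderiv ℝ (christoffel G) x).flip v).flip w - (fderiv ℝ (christoffel G) x v).flip w
    + (christoffel G x).flip (christoffel G x v w)
    - (christoffel G x v).comp ((christoffel G x).flip w)

theorem curvatureEndo_apply (G : E → E →L[ℝ] E →L[ℝ] ℝ) (x u v w : E) :
    curvatureEndo G x v w u
      = fderiv ℝ (christoffel G) x u v w - fderiv ℝ (christoffel G) x v u w
        + christoffel G x u (christoffel G x v w) - christoffel G x v (christoffel G x u w) := rfl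

/-- The Ricci tensor in coordinates: `Ric(v, w)` is the trace of `u ↦ R(u, v) w`. -/
def localRicci [FiniteDimensional ℝ E] (G : E → E →L[ℝ] E →L[ℝ] ℝ) (x : E) :
    E →L[ℝ] E →L[ℝ] ℝ :=
  LinearMap.toContinuousBilinearMap <|
    LinearMap.mk₂ ℝ (fun v w => LinearMap.trace ℝ E (curvatureEndo G x v w : E →ₗ[ℝ] E))
      (fun v v' w => by
        rw [← map_add]; congr 1; ext u
        simp [curvatureEndo_apply]; abel)
      (fun c v w => by
        rw [← map_smul]; congr 1; ext u
        simp [curvatureEndo_apply, smul_sub, smul_add])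
      (fun v w w' => by
        rw [← map_add]; congr 1; ext u
        simp [curvatureEndo_apply]; abel)
      (fun c v w => by
        rw [← map_smul]; congr 1; ext u
        simp [curvatureEndo_apply, smul_sub, smul_add])

theorem localRicci_apply [FiniteDimensional ℝ E] (G : E → E →L[ℝ] E →L[ℝ] ℝ) (x v w : E) :
    localRicci G x v w = LinearMap.trace ℝ E (curvatureEndo G x v w : E →ₗ[ℝ] E) := rfl

/-- The Hessian in coordinates: `(∇ dh)(u, v) = D²h(u, v) - Dh(Γ(u, v))`. -/
def localHessian (G : E → E →L[ℝ] E →L[ℝ] ℝ) (h : E → ℝ) (x : E) : E →L[ℝ] E →L[ℝ] ℝ :=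
  fderiv ℝ (fderiv ℝ h) x
    - (ContinuousLinearMap.compL ℝ E E ℝ (fderiv ℝ h x)).comp (christoffel G x)

theorem localHessian_apply (G : E → E →L[ℝ] E →L[ℝ] ℝ) (h : E → ℝ) (x u v : E) :
    localHessian G h x u v
      = fderiv ℝ (fderiv ℝ h) x u v - fderiv ℝ h x (christoffel G x u v) := rfl

end Local

/-! ### Tensors on a manifold without boundary -/

section Global

variable {E : Type*} [NormedAddCommGroup E] [NormedSpace ℝ E]
  {H : Type*} [TopologicalSpace H] (I : ModelWithCorners ℝ E H)
  {M : Type*} [TopologicalSpace M] [ChartedSpace H M]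

/-- The `g`-trace of a bilinear form `β` on the tangent space at `p`: the trace of the
endomorphism obtained from `β` by raising an index with `g`. -/
def traceAt (g : ∀ p : M, TangentSpace I p →L[ℝ] TangentSpace I p →L[ℝ] ℝ) (p : M)
    (β : TangentSpace I p →L[ℝ] TangentSpace I p →L[ℝ] ℝ) : ℝ :=
  LinearMap.trace ℝ (TangentSpace I p)
    ((g p).inverse.comp β : TangentSpace I p →L[ℝ] TangentSpace I p)

/-- The metric `g` in the chart `φ` at `p`: the pullback of `g` under `φ⁻¹`, a field of bilinear
forms on the model space. (For the models without boundary used here, `Set.range I` is the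
whole space.) -/
def inChart (g : ∀ p : M, TangentSpace I p →L[ℝ] TangentSpace I p →L[ℝ] ℝ) (p : M) (y : E) :
    E →L[ℝ] E →L[ℝ] ℝ :=
  pullback (g ((extChartAt I p).symm y))
    (mfderivWithin 𝓘(ℝ, E) I (extChartAt I p).symm (Set.range I) y)

/-- The Ricci tensor of `g`, computed at `p` in the chart at `p`
and pulled back to the tangent space at `p` by the derivative of the chart. -/
def ricci [FiniteDimensional ℝ E]
    (g : ∀ p : M, TangentSpace I p →L[ℝ] TangentSpace I p →L[ℝ] ℝ) (p : M) :
    TangentSpace I p →L[ℝ] TangentSpace I p →L[ℝ] ℝ :=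
  pullback (localRicci (inChart I g p) (extChartAt I p p))
    (mfderiv I 𝓘(ℝ, E) (extChartAt I p) p)

/-- The scalar curvature: the `g`-trace of the Ricci tensor. -/
def scalarCurvature [FiniteDimensional ℝ E]
    (g : ∀ p : M, TangentSpace I p →L[ℝ] TangentSpace I p →L[ℝ] ℝ) (p : M) : ℝ :=
  traceAt I g p (ricci I g p)

/-- The Hessian tensor of the function `f` with respect to `g`. -/
def hessian (g : ∀ p : M, TangentSpace I p →L[ℝ] TangentSpace I p →L[ℝ] ℝ) (f : M → ℝ) (p : M) :
    TangentSpace I p →L[ℝ] TangentSpace I p →L[ℝ] ℝ :=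
  pullback (localHessian (inChart I g p) (f ∘ (extChartAt I p).symm) (extChartAt I p p))
    (mfderiv I 𝓘(ℝ, E) (extChartAt I p) p)

/-- The Laplace-Beltrami operator: the `g`-trace of the Hessian. -/
def laplacian (g : ∀ p : M, TangentSpace I p →L[ℝ] TangentSpace I p →L[ℝ] ℝ) (f : M → ℝ) (p : M) :
    ℝ :=
  traceAt I g p (hessian I g f p)

/-- The tensor `ℒ*_g f = -f Ric_g - (Δ_g f) g + Hess_g f`. -/
def adjointScalar [FiniteDimensional ℝ E]
    (g : ∀ p : M, TangentSpace I p →L[ℝ] TangentSpace I p →L[ℝ] ℝ) (f : M → ℝ) (p : M) :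
    TangentSpace I p →L[ℝ] TangentSpace I p →L[ℝ] ℝ :=
  -(f p • ricci I g p) - laplacian I g f p • g p + hessian I g f p

/-- The energy-momentum tensor `T` given by Einstein's equation `Ric - (1/2) τ g = 8 π T`. -/
def energyMomentum [FiniteDimensional ℝ E]
    (g : ∀ p : M, TangentSpace I p →L[ℝ] TangentSpace I p →L[ℝ] ℝ) (p : M) :
    TangentSpace I p →L[ℝ] TangentSpace I p →L[ℝ] ℝ :=
  (1 / (8 * Real.pi)) • (ricci I g p - (1 / 2 * scalarCurvature I g p) • g p)

/-- A tangent vector is causal if it is nonzero and timelike or null. -/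
def IsCausal (g : ∀ p : M, TangentSpace I p →L[ℝ] TangentSpace I p →L[ℝ] ℝ) (p : M)
    (w : TangentSpace I p) : Prop :=
  w ≠ 0 ∧ g p w w ≤ 0

end Global

/-! ### Standard static space-times -/

/-- The open interval `(t₁, t₂)` of real numbers, with possibly infinite end points. -/
def openInterval (t₁ t₂ : EReal) : TopologicalSpace.Opens ℝ where
  carrier := {t : ℝ | t₁ < (t : EReal) ∧ (t : EReal) < t₂}
  is_open' :=
    (isOpen_lt continuous_const continuous_coe_real_ereal).inter
      (isOpen_lt continuous_coe_real_ereal continuous_const)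

section Static

variable {E : Type*} [NormedAddCommGroup E] [NormedSpace ℝ E]
  {F : Type*} [TopologicalSpace F] [ChartedSpace E F]

/-- The differential at `x` of the projection `I × F → I ⊆ ℝ`, i.e. the one-form `dt`. -/
def dt (J : TopologicalSpace.Opens ℝ) (x : J × F) :
    TangentSpace (𝓘(ℝ, ℝ).prod 𝓘(ℝ, E)) x →L[ℝ] ℝ :=
  mfderiv (𝓘(ℝ, ℝ).prod 𝓘(ℝ, E)) 𝓘(ℝ, ℝ) (fun y : J × F => (y.1 : ℝ)) x

/-- The metric `-f² dt² ⊕ g_F` on the product of an open subset of the line with `F`; the second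
summand is the pullback of `g_F` by the projection to `F`. -/
def staticMetric (J : TopologicalSpace.Opens ℝ) (f : F → ℝ)
    (gF : ∀ p : F, TangentSpace 𝓘(ℝ, E) p →L[ℝ] TangentSpace 𝓘(ℝ, E) p →L[ℝ] ℝ) (x : J × F) :
    TangentSpace (𝓘(ℝ, ℝ).prod 𝓘(ℝ, E)) x →L[ℝ]
      TangentSpace (𝓘(ℝ, ℝ).prod 𝓘(ℝ, E)) x →L[ℝ] ℝ :=
  -(f x.2 ^ 2 • pullback (ContinuousLinearMap.mul ℝ ℝ) (dt J x))
    + pullback (gF x.2)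
      (mfderiv (𝓘(ℝ, ℝ).prod 𝓘(ℝ, E)) 𝓘(ℝ, E) (Prod.snd : J × F → F) x)

end Static

end PseudoRiem

end

noncomputable section

namespace PseudoRiem

/-! ### Finite-dimensional bilinear forms and traces -/

section LinearAlgebra

variable {E : Type*} [NormedAddCommGroup E] [NormedSpace ℝ E] [FiniteDimensional ℝ E]

/-! Everything follows from one identity on `I × F`, where w_F is the F-component of w: 8πT(w, w) =
-f⁻¹ ℒ*f(w_F, w_F) - ½ τ_F g(w, w), proved in `energyMomentum_staticMetric`. For causal w, -g(w, w)
≥ 0, so both sign statements are immediate. If ℒ*f vanishes, only the τ_F term survives, and testing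
on the timelike vector ∂_t, where g(∂_t, ∂_t) = -f², recovers the sign of τ_F.

The identity is local. With φ the lapse in coordinates, the Christoffel symbols of -φ²dt² ⊕ γ give
Ric = Ric_γ - φ⁻¹ Hess φ + φ Δφ dt² and τ = τ_γ - 2 Δφ/φ (`localRicci_localStatic`,
`trace_localRicci_localStatic`). In Ric - ½τg the dt² terms containing Δφ cancel, leaving
`einstein_localStatic`. The local result transfers to the manifold because in product charts the
metric has exactly this form near the base point (`inChart_staticMetric`), and curvature depends
only on the germ of the metric (`localRicci_congr`). -/

theorem isInvertible_of_injective (B : E →L[ℝ] E →L[ℝ] ℝ) (hB : Function.Injective B) :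
    B.IsInvertible := by
  have e : (E →L[ℝ] ℝ) ≃ₗ[ℝ] Module.Dual ℝ E := LinearMap.toContinuousLinearMap.symm
  have hd : Module.finrank ℝ E = Module.finrank ℝ (E →L[ℝ] ℝ) := by
    rw [e.finrank_eq, Subspace.dual_finrank_eq]
  refine ⟨(LinearEquiv.ofInjectiveOfFinrankEq B.toLinearMap hB hd).toContinuousLinearEquiv, ?_⟩
  ext u v
  rfl

theorem isInvertible_of_pos (B : E →L[ℝ] E →L[ℝ] ℝ) (hB : ∀ v, v ≠ 0 → 0 < B v v) :
    B.IsInvertible := by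
  refine isInvertible_of_injective B ((injective_iff_map_eq_zero B).2 fun v hv => ?_)
  by_contra h
  simpa [hv] using hB v h

/-- Split A along the two inclusions and use cyclicity of the trace; this separates time and space
contributions to every trace below. -/
theorem trace_prod_eq (A : (ℝ × E) →ₗ[ℝ] (ℝ × E)) :
    LinearMap.trace ℝ (ℝ × E) A
      = (A (1, 0)).1 + LinearMap.trace ℝ E (LinearMap.snd ℝ ℝ E ∘ₗ A ∘ₗ LinearMap.inr ℝ ℝ E) := by
  have h : A = (A ∘ₗ LinearMap.inl ℝ ℝ E) ∘ₗ LinearMap.fst ℝ ℝ E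
      + (A ∘ₗ LinearMap.inr ℝ ℝ E) ∘ₗ LinearMap.snd ℝ ℝ E := by
    have h0 : ((0 : ℝ), (0 : E)) = 0 := rfl
    ext <;> simp [h0]
  conv_lhs => rw [h]
  rw [map_add, LinearMap.trace_comp_comm', LinearMap.trace_comp_comm' _ (LinearMap.snd ℝ ℝ E)]
  congr 1
  have h1 (L : ℝ →ₗ[ℝ] ℝ) : LinearMap.trace ℝ ℝ L = L 1 := by
    rw [LinearMap.trace_eq_matrix_trace ℝ (Module.Basis.singleton Unit ℝ)]
    simp [Matrix.trace, LinearMap.toMatrix_apply]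
  rw [h1]
  rfl

end LinearAlgebra

/-! ### Derivatives of operator-valued maps -/

section Calculus

variable {V X Y Z : Type*} [NormedAddCommGroup V] [NormedSpace ℝ V] [NormedAddCommGroup X]
  [NormedSpace ℝ X] [NormedAddCommGroup Y] [NormedSpace ℝ Y] [NormedAddCommGroup Z]
  [NormedSpace ℝ Z]

theorem fderiv_clm_apply_const {A : V → X →L[ℝ] Z} {x : V} (hA : DifferentiableAt ℝ A x)
    (u : V) (v : X) : fderiv ℝ A x u v = fderiv ℝ (fun y => A y v) x u := by
  rw [(hA.hasFDerivAt.clm_apply (hasFDerivAt_const v x)).fderiv]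
  simp

theorem fderiv_clm_apply_const₂ {A : V → X →L[ℝ] Y →L[ℝ] Z} {x : V}
    (hA : DifferentiableAt ℝ A x) (u : V) (v : X) (w : Y) :
    fderiv ℝ A x u v w = fderiv ℝ (fun y => A y v w) x u := by
  rw [fderiv_clm_apply_const hA,
    fderiv_clm_apply_const (hA.clm_apply (differentiableAt_const v))]

theorem fderiv_comp_snd {h : V → Z} {z : ℝ × V} (hh : DifferentiableAt ℝ h z.2) (u : ℝ × V) :
    fderiv ℝ (fun z : ℝ × V => h z.2) z u = fderiv ℝ h z.2 u.2 := by
  have h1 : HasFDerivAt (fun z : ℝ × V => h z.2) _ z := hh.hasFDerivAt.comp z hasFDerivAt_snd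
  rw [h1.fderiv]
  rfl

end Calculus

/-! ### Levi-Civita connection in coordinates -/

section LeviCivita

variable {E : Type*} [NormedAddCommGroup E] [NormedSpace ℝ E]
  {G : E → E →L[ℝ] E →L[ℝ] ℝ} {x : E}

theorem apply_christoffel (hG : (G x).IsInvertible) (u v w : E) :
    2 * G x (christoffel G x u v) w = koszul G x u v w := by
  rw [christoffel_apply, map_smul, hG.self_apply_inverse]
  simp

theorem christoffel_eq_of_koszul (hG : (G x).IsInvertible) {u v X : E}
    (h : ∀ w, 2 * G x X w = koszul G x u v w) : christoffel G x u v = X := by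
  apply hG.injective
  ext w
  linarith [h w, apply_christoffel hG u v w]

theorem fderiv_metric_symm (hd : DifferentiableAt ℝ G x)
    (hs : ∀ᶠ y in nhds x, ∀ u v, G y u v = G y v u) (w u v : E) :
    fderiv ℝ G x w u v = fderiv ℝ G x w v u := by
  rw [fderiv_clm_apply_const₂ hd, fderiv_clm_apply_const₂ hd]
  have : (fun y => G y u v) =ᶠ[nhds x] fun y => G y v u := hs.mono fun y hy => hy u v
  rw [this.fderiv_eq]

/-- Metric compatibility ∇G = 0: in K(u, v, w) + K(u, w, v) all terms cancel except those
differentiating along u. -/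
theorem fderiv_metric_eq (hG : (G x).IsInvertible) (hd : DifferentiableAt ℝ G x)
    (hs : ∀ᶠ y in nhds x, ∀ u v, G y u v = G y v u) (u v w : E) :
    fderiv ℝ G x u v w = G x (christoffel G x u v) w + G x (christoffel G x u w) v := by
  have h1 := apply_christoffel hG u v w
  have h2 := apply_christoffel hG u w v
  rw [koszul_apply] at h1 h2
  linarith [fderiv_metric_symm hd hs u v w, fderiv_metric_symm hd hs v u w,
    fderiv_metric_symm hd hs w u v]

theorem contDiffAt_inverse [CompleteSpace E] {n : ℕ∞ω} (hG : (G x).IsInvertible)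
    (hc : ContDiffAt ℝ n G x) : ContDiffAt ℝ n (fun y => (G y).inverse) x :=
  hG.contDiffAt_map_inverse.comp x hc

theorem differentiableAt_koszul (hc : ContDiffAt ℝ 2 G x) : DifferentiableAt ℝ (koszul G) x := by
  have h1 : DifferentiableAt ℝ (fderiv ℝ G) x :=
    (hc.fderiv_right (m := 1) (by norm_num)).differentiableAt (by norm_num)
  have h2 : DifferentiableAt ℝ (fun y => (fderiv ℝ G y).flip) x :=
    ((ContinuousLinearMap.flipₗᵢ ℝ E E (E →L[ℝ] ℝ)).toContinuousLinearEquiv.toContinuousLinearMap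
      ).differentiableAt.comp x h1
  exact (h1.add h2).sub ((differentiableAt_const _).clm_comp h2)

theorem differentiableAt_christoffel [CompleteSpace E] (hG : (G x).IsInvertible)
    (hc : ContDiffAt ℝ 2 G x) : DifferentiableAt ℝ (christoffel G) x := by
  have h1 : DifferentiableAt ℝ (fun y => (G y).inverse) x :=
    (contDiffAt_inverse hG hc).differentiableAt (by norm_num)
  exact ((((ContinuousLinearMap.compL ℝ E (E →L[ℝ] ℝ) E).differentiableAt.comp x h1).clm_comp
    (differentiableAt_koszul hc)).const_smul (1 / 2 : ℝ))

/-- The coordinate expression of the gradient. -/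
def localGrad (G : E → E →L[ℝ] E →L[ℝ] ℝ) (h : E → ℝ) (x : E) : E :=
  (G x).inverse (fderiv ℝ h x)

theorem apply_localGrad (hG : (G x).IsInvertible) (h : E → ℝ) (w : E) :
    G x (localGrad G h x) w = fderiv ℝ h x w := by
  rw [localGrad, hG.self_apply_inverse]

theorem differentiableAt_localGrad [CompleteSpace E] (hG : (G x).IsInvertible)
    (hc : ContDiffAt ℝ 2 G x) {h : E → ℝ} (hh : ContDiffAt ℝ 2 h x) :
    DifferentiableAt ℝ (localGrad G h) x :=
  ((contDiffAt_inverse hG hc).differentiableAt (by norm_num)).clm_apply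
    ((hh.fderiv_right (m := 1) (by norm_num)).differentiableAt (by norm_num))

/-- `∇_u grad h` is obtained from the Hessian of `h` by raising an index. -/
theorem fderiv_localGrad_add_christoffel [CompleteSpace E]
    (hG : ∀ᶠ y in nhds x, (G y).IsInvertible)
    (hc : ContDiffAt ℝ 2 G x) (hs : ∀ᶠ y in nhds x, ∀ u v, G y u v = G y v u)
    {h : E → ℝ} (hh : ContDiffAt ℝ 2 h x) (u : E) :
    fderiv ℝ (localGrad G h) x u + christoffel G x u (localGrad G h x)
      = (G x).inverse (localHessian G h x u) := by
  have hGx := hG.self_of_nhds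
  have hd : DifferentiableAt ℝ G x := hc.differentiableAt (by norm_num)
  have hg := differentiableAt_localGrad hGx hc hh
  apply hGx.injective
  rw [hGx.self_apply_inverse]
  ext w
  -- Differentiate G(grad h, w) = dh(w) along u, then remove the derivative of G by metric
  -- compatibility.
  have key : (fun y => G y (localGrad G h y) w) =ᶠ[nhds x] fun y => fderiv ℝ h y w :=
    hG.mono fun y hy => apply_localGrad hy h w
  have hL : fderiv ℝ (fun y => G y (localGrad G h y) w) x u
      = fderiv ℝ G x u (localGrad G h x) w + G x (fderiv ℝ (localGrad G h) x u) w := by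
    rw [((hd.hasFDerivAt.clm_apply hg.hasFDerivAt).clm_apply (hasFDerivAt_const w x)).fderiv]
    simp [add_comm]
  have hR : fderiv ℝ (fun y => fderiv ℝ h y w) x u = fderiv ℝ (fderiv ℝ h) x u w :=
    (fderiv_clm_apply_const
      ((hh.fderiv_right (m := 1) (by norm_num)).differentiableAt (by norm_num)) u w).symm
  rw [key.fderiv_eq, hR, fderiv_metric_eq hGx hd hs, hs.self_of_nhds _ (localGrad G h x),
    apply_localGrad hGx] at hL
  rw [localHessian_apply, hL, map_add, add_apply]
  ring

end LeviCivita

/-! ### Curvature of a static metric in coordinates -/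

section LocalStatic

variable {E : Type*} [NormedAddCommGroup E] [NormedSpace ℝ E]

/-- The coordinate expression `-φ² dt² ⊕ γ` of a static metric. -/
def localStatic (φ : E → ℝ) (γ : E → E →L[ℝ] E →L[ℝ] ℝ) (z : ℝ × E) :
    (ℝ × E) →L[ℝ] (ℝ × E) →L[ℝ] ℝ :=
  -(φ z.2 ^ 2 • pullback (ContinuousLinearMap.mul ℝ ℝ) (ContinuousLinearMap.fst ℝ ℝ E))
    + pullback (γ z.2) (ContinuousLinearMap.snd ℝ ℝ E)

variable {φ : E → ℝ} {γ : E → E →L[ℝ] E →L[ℝ] ℝ}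

theorem localStatic_apply (z v w : ℝ × E) :
    localStatic φ γ z v w = -(φ z.2 ^ 2 * (v.1 * w.1)) + γ z.2 v.2 w.2 := rfl

theorem contDiffAt_localStatic {n : ℕ∞ω} {z : ℝ × E} (hφ : ContDiffAt ℝ n φ z.2)
    (hγ : ContDiffAt ℝ n γ z.2) : ContDiffAt ℝ n (localStatic φ γ) z := by
  have h1 : ContDiffAt ℝ n (fun z : ℝ × E => φ z.2) z := hφ.comp z contDiffAt_snd
  have h2 : ContDiffAt ℝ n (fun z : ℝ × E => γ z.2) z := hγ.comp z contDiffAt_snd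
  exact ((h1.pow 2).smul contDiffAt_const).neg.add
    (contDiffAt_const.clm_comp (h2.clm_comp contDiffAt_const))

variable [FiniteDimensional ℝ E]

theorem isInvertible_localStatic {z : ℝ × E} (hφ : φ z.2 ≠ 0) (hγ : (γ z.2).IsInvertible) :
    (localStatic φ γ z).IsInvertible := by
  refine isInvertible_of_injective _ ((injective_iff_map_eq_zero _).2 fun v hv => ?_)
  have h (w : ℝ × E) : -(φ z.2 ^ 2 * (v.1 * w.1)) + γ z.2 v.2 w.2 = 0 := by
    rw [← localStatic_apply, hv]; rfl
  have h1 : v.1 = 0 := by simpa [hφ] using h (1, 0)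
  have h2 : v.2 = 0 := by
    apply hγ.injective
    ext w
    simpa using h (0, w)
  exact Prod.ext h1 h2

/-- The coefficients do not depend on t, so beyond the symbols of γ only derivatives of -φ² enter:
they give the dφ/φ terms in the time slot and φ grad φ in the space slot. The formula is verified
through the Koszul identity. -/
theorem christoffel_localStatic {z : ℝ × E} (hφ : φ z.2 ≠ 0) (hγ : (γ z.2).IsInvertible)
    (dφ : ContDiffAt ℝ 1 φ z.2) (dγ : ContDiffAt ℝ 1 γ z.2) (u v : ℝ × E) :
    christoffel (localStatic φ γ) z u v
      = ((fderiv ℝ φ z.2 u.2 * v.1 + fderiv ℝ φ z.2 v.2 * u.1) / φ z.2,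
        christoffel γ z.2 u.2 v.2 + (φ z.2 * (u.1 * v.1)) • localGrad γ φ z.2) := by
  have hφd := dφ.differentiableAt one_ne_zero
  have hγd := dγ.differentiableAt one_ne_zero
  have key (u v w : ℝ × E) : fderiv ℝ (localStatic φ γ) z u v w
      = -(2 * φ z.2 * fderiv ℝ φ z.2 u.2 * (v.1 * w.1)) + fderiv ℝ γ z.2 u.2 v.2 w.2 := by
    rw [fderiv_clm_apply_const₂
      ((contDiffAt_localStatic dφ dγ).differentiableAt one_ne_zero)]
    have h1 : HasFDerivAt (fun y => -(φ y ^ 2 * (v.1 * w.1)) + γ y v.2 w.2) _ z.2 :=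
      ((hφd.hasFDerivAt.pow 2).mul_const (v.1 * w.1)).neg.add
        ((hγd.hasFDerivAt.clm_apply (hasFDerivAt_const v.2 z.2)).clm_apply
          (hasFDerivAt_const w.2 z.2))
    simp only [localStatic_apply]
    rw [fderiv_comp_snd (h := fun y => -(φ y ^ 2 * (v.1 * w.1)) + γ y v.2 w.2)
      h1.differentiableAt, h1.fderiv]
    simp
    ring
  refine christoffel_eq_of_koszul (isInvertible_localStatic hφ hγ) fun w => ?_
  have h2 := apply_christoffel hγ u.2 v.2 w.2
  have h3 := apply_localGrad hγ φ w.2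
  rw [koszul_apply] at h2 ⊢
  rw [key, key, key, localStatic_apply]
  simp only [map_add, map_smul, add_apply, smul_apply, smul_eq_mul]
  rw [h3]
  field_simp
  linear_combination h2

variable {z : ℝ × E}

/-- The nondegeneracy and regularity conditions on the lapse `φ` and on the Riemannian metric `γ`
near `y`. -/
structure IsStaticDatum (φ : E → ℝ) (γ : E → E →L[ℝ] E →L[ℝ] ℝ) (y : E) : Prop where
  lapse : ContDiffAt ℝ 2 φ y
  metric : ContDiffAt ℝ 2 γ y
  ne_zero : ∀ᶠ x in nhds y, φ x ≠ 0
  invertible : ∀ᶠ x in nhds y, (γ x).IsInvertible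
  symm : ∀ᶠ x in nhds y, ∀ u v, γ x u v = γ x v u

namespace IsStaticDatum

/-- Curvature differentiates the symbols, so the closed form is needed on a neighbourhood, not only
at z. -/
theorem christoffel_eventuallyEq (h : IsStaticDatum φ γ z.2) (u v : ℝ × E) :
    (fun z => christoffel (localStatic φ γ) z u v) =ᶠ[nhds z]
      fun z => ((fderiv ℝ φ z.2 u.2 * v.1 + fderiv ℝ φ z.2 v.2 * u.1) / φ z.2,
        christoffel γ z.2 u.2 v.2 + (φ z.2 * (u.1 * v.1)) • localGrad γ φ z.2) := by
  have H : ∀ᶠ x in nhds z.2, φ x ≠ 0 ∧ (γ x).IsInvertible ∧ ContDiffAt ℝ 1 φ x ∧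
      ContDiffAt ℝ 1 γ x :=
    h.ne_zero.and <| h.invertible.and <|
      ((h.lapse.of_le (by norm_num)).eventually (by simp)).and
        ((h.metric.of_le (by norm_num)).eventually (by simp))
  filter_upwards [continuous_snd.continuousAt.eventually H] with x hx
  exact christoffel_localStatic hx.1 hx.2.1 hx.2.2.1 hx.2.2.2 u v

theorem fderiv_christoffel (h : IsStaticDatum φ γ z.2) (u v w : ℝ × E) :
    fderiv ℝ (christoffel (localStatic φ γ)) z u v w
      = ((fderiv ℝ (fderiv ℝ φ) z.2 u.2 v.2 * w.1 + fderiv ℝ (fderiv ℝ φ) z.2 u.2 w.2 * v.1)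
            / φ z.2
          - (fderiv ℝ φ z.2 v.2 * w.1 + fderiv ℝ φ z.2 w.2 * v.1) * fderiv ℝ φ z.2 u.2
            / φ z.2 ^ 2,
        fderiv ℝ (christoffel γ) z.2 u.2 v.2 w.2
          + (fderiv ℝ φ z.2 u.2 * (v.1 * w.1)) • localGrad γ φ z.2
          + (φ z.2 * (v.1 * w.1)) • fderiv ℝ (localGrad γ φ) z.2 u.2) := by
  have h0 := h.ne_zero.self_of_nhds
  have hi := h.invertible.self_of_nhds
  have dφ : DifferentiableAt ℝ φ z.2 := h.lapse.differentiableAt (by norm_num)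
  have ddφ : DifferentiableAt ℝ (fderiv ℝ φ) z.2 :=
    (h.lapse.fderiv_right (m := 1) (by norm_num)).differentiableAt (by norm_num)
  have dΓ := differentiableAt_christoffel hi h.metric
  have dg := differentiableAt_localGrad hi h.metric h.lapse
  rw [fderiv_clm_apply_const₂ (differentiableAt_christoffel (isInvertible_localStatic h0 hi)
    (contDiffAt_localStatic h.lapse h.metric)), (h.christoffel_eventuallyEq v w).fderiv_eq]
  have e (a : E) := ddφ.hasFDerivAt.clm_apply (hasFDerivAt_const a z.2)
  have h1 : HasFDerivAt (fun y => ((fderiv ℝ φ y v.2 * w.1 + fderiv ℝ φ y w.2 * v.1) * (φ y)⁻¹,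
      christoffel γ y v.2 w.2 + (φ y * (v.1 * w.1)) • localGrad γ φ y)) _ z.2 :=
    ((((e v.2).mul_const w.1).add ((e w.2).mul_const v.1)).mul
      ((hasDerivAt_inv h0).comp_hasFDerivAt z.2 dφ.hasFDerivAt)).prodMk
    (((dΓ.hasFDerivAt.clm_apply (hasFDerivAt_const v.2 z.2)).clm_apply
      (hasFDerivAt_const w.2 z.2)).add
      ((dφ.hasFDerivAt.mul_const (v.1 * w.1)).smul dg.hasFDerivAt))
  simp only [div_eq_mul_inv]
  rw [fderiv_comp_snd (h := fun y => ((fderiv ℝ φ y v.2 * w.1 + fderiv ℝ φ y w.2 * v.1) * (φ y)⁻¹,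
      christoffel γ y v.2 w.2 + (φ y * (v.1 * w.1)) • localGrad γ φ y)) h1.differentiableAt,
    h1.fderiv]
  ext
  · simp
    ring
  · simp [add_assoc, add_comm, mul_comm]

theorem curvatureEndo_time (h : IsStaticDatum φ γ z.2) (v w : ℝ × E) :
    (curvatureEndo (localStatic φ γ) z v w (1, 0)).1 = -(localHessian γ φ z.2 v.2 w.2 / φ z.2) := by
  have h0 := h.ne_zero.self_of_nhds
  have c (u v : ℝ × E) := (h.christoffel_eventuallyEq u v).self_of_nhds
  rw [curvatureEndo_apply, h.fderiv_christoffel, h.fderiv_christoffel, localHessian_apply]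
  simp only [c]
  simp
  field_simp
  ring

theorem curvatureEndo_space (h : IsStaticDatum φ γ z.2) (v w : ℝ × E) (u : E) :
    (curvatureEndo (localStatic φ γ) z v w (0, u)).2
      = curvatureEndo γ z.2 v.2 w.2 u
        + (φ z.2 * (v.1 * w.1)) • (γ z.2).inverse (localHessian γ φ z.2 u) := by
  have h0 := h.ne_zero.self_of_nhds
  have c (u v : ℝ × E) := (h.christoffel_eventuallyEq u v).self_of_nhds
  rw [← fderiv_localGrad_add_christoffel h.invertible h.metric h.symm h.lapse,
    curvatureEndo_apply, h.fderiv_christoffel, h.fderiv_christoffel, curvatureEndo_apply]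
  simp only [c]
  -- This coefficient of grad φ, coming from Γ(v, Γ(u, w)), cancels the dφ(u) term of the
  -- differentiated symbol. What remains is φ v₁ w₁ ∇_u grad φ, the Hessian with an index raised.
  have e : φ z.2 * (v.1 * (fderiv ℝ φ z.2 u * w.1 / φ z.2)) = fderiv ℝ φ z.2 u * (v.1 * w.1) := by
    field_simp
  simp [e]
  module

theorem localRicci_localStatic (h : IsStaticDatum φ γ z.2) (v w : ℝ × E) :
    localRicci (localStatic φ γ) z v w
      = localRicci γ z.2 v.2 w.2 - localHessian γ φ z.2 v.2 w.2 / φ z.2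
        + φ z.2 * (v.1 * w.1)
          * LinearMap.trace ℝ E ((γ z.2).inverse.comp (localHessian γ φ z.2) : E →L[ℝ] E) := by
  rw [localRicci_apply, localRicci_apply, trace_prod_eq]
  have e : LinearMap.snd ℝ ℝ E ∘ₗ (curvatureEndo (localStatic φ γ) z v w : _ →ₗ[ℝ] (ℝ × E))
      ∘ₗ LinearMap.inr ℝ ℝ E
      = (curvatureEndo γ z.2 v.2 w.2 : E →ₗ[ℝ] E) + (φ z.2 * (v.1 * w.1)) •
        ((γ z.2).inverse.comp (localHessian γ φ z.2) : E →L[ℝ] E).toLinearMap := by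
    ext u
    exact h.curvatureEndo_space v w u
  rw [e, map_add, map_smul, smul_eq_mul]
  have := h.curvatureEndo_time v w
  simp only [ContinuousLinearMap.coe_coe]
  rw [this]
  ring

theorem trace_localRicci_localStatic (h : IsStaticDatum φ γ z.2) :
    LinearMap.trace ℝ (ℝ × E) ((localStatic φ γ z).inverse.comp
        (localRicci (localStatic φ γ) z) : (ℝ × E) →L[ℝ] (ℝ × E))
      = LinearMap.trace ℝ E ((γ z.2).inverse.comp (localRicci γ z.2) : E →L[ℝ] E)
        - 2 * LinearMap.trace ℝ E ((γ z.2).inverse.comp (localHessian γ φ z.2) : E →L[ℝ] E)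
          / φ z.2 := by
  have h0 := h.ne_zero.self_of_nhds
  have hi := h.invertible.self_of_nhds
  have hI := isInvertible_localStatic h0 hi
  -- The Laplacian is treated as an opaque number L.
  obtain ⟨L, hL⟩ : ∃ L, LinearMap.trace ℝ E
      ((γ z.2).inverse.comp (localHessian γ φ z.2) : E →L[ℝ] E) = L := ⟨_, rfl⟩
  have hR := h.localRicci_localStatic
  rw [hL] at hR ⊢
  -- The Ricci endomorphism is block diagonal. Its time entry -L/φ and the Hessian part of its space
  -- block each contribute -L/φ to the trace.
  have key (u : ℝ × E) : (localStatic φ γ z).inverse (localRicci (localStatic φ γ) z u)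
      = (-(L * u.1 / φ z.2), (γ z.2).inverse (localRicci γ z.2 u.2)
        - (φ z.2)⁻¹ • (γ z.2).inverse (localHessian γ φ z.2 u.2)) := by
    apply hI.injective
    rw [hI.self_apply_inverse]
    ext w
    · rw [ContinuousLinearMap.comp_apply, ContinuousLinearMap.comp_apply,
        hR, localStatic_apply]
      simp
      field_simp
    · rw [ContinuousLinearMap.comp_apply, ContinuousLinearMap.comp_apply,
        hR, localStatic_apply, map_sub, map_smul,
        hi.self_apply_inverse, hi.self_apply_inverse]
      simp
      ring
  rw [trace_prod_eq]
  have e : LinearMap.snd ℝ ℝ E ∘ₗ ((localStatic φ γ z).inverse.comp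
        (localRicci (localStatic φ γ) z) : (ℝ × E) →L[ℝ] (ℝ × E)).toLinearMap
      ∘ₗ LinearMap.inr ℝ ℝ E
      = ((γ z.2).inverse.comp (localRicci γ z.2) : E →L[ℝ] E).toLinearMap - (φ z.2)⁻¹ •
        ((γ z.2).inverse.comp (localHessian γ φ z.2) : E →L[ℝ] E).toLinearMap := by
    ext u
    exact congr_arg Prod.snd (key (0, u))
  rw [e, map_sub, map_smul, hL, ContinuousLinearMap.coe_coe, ContinuousLinearMap.comp_apply, key]
  simp
  ring

/-- The local form of the identity `Ric - (1/2) τ g = -f⁻¹ ℒ* f - (1/2) τ_F g`. -/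
theorem einstein_localStatic (h : IsStaticDatum φ γ z.2) (w : ℝ × E) :
    localRicci (localStatic φ γ) z w w - 1 / 2 * LinearMap.trace ℝ (ℝ × E)
        ((localStatic φ γ z).inverse.comp (localRicci (localStatic φ γ) z) :
          (ℝ × E) →L[ℝ] (ℝ × E)) * localStatic φ γ z w w
      = -((φ z.2)⁻¹ * (-(φ z.2 * localRicci γ z.2 w.2 w.2)
          - LinearMap.trace ℝ E ((γ z.2).inverse.comp (localHessian γ φ z.2) : E →L[ℝ] E)
            * γ z.2 w.2 w.2 + localHessian γ φ z.2 w.2 w.2))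
        - 1 / 2 * LinearMap.trace ℝ E ((γ z.2).inverse.comp (localRicci γ z.2) : E →L[ℝ] E)
          * localStatic φ γ z w w := by
  have h0 := h.ne_zero.self_of_nhds
  -- The term φ Δφ w₁² of Ric cancels against (Δφ/φ)(-φ² w₁²) from -½τg.
  rw [h.trace_localRicci_localStatic, h.localRicci_localStatic, localStatic_apply]
  field_simp
  ring

end IsStaticDatum

end LocalStatic

/-! ### Dependence on the germ of the metric -/

section Congr

variable {E : Type*} [NormedAddCommGroup E] [NormedSpace ℝ E]
  {G G' : E → E →L[ℝ] E →L[ℝ] ℝ} {x : E}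

theorem christoffel_congr (h : G =ᶠ[nhds x] G') : christoffel G =ᶠ[nhds x] christoffel G' := by
  filter_upwards [h, h.fderiv (𝕜 := ℝ)] with y h1 h2
  ext u v
  rw [christoffel_apply, christoffel_apply, koszul, koszul, h1, h2]

theorem localRicci_congr [FiniteDimensional ℝ E] (h : G =ᶠ[nhds x] G') :
    localRicci G x = localRicci G' x := by
  have h1 := christoffel_congr h
  ext v w
  rw [localRicci_apply, localRicci_apply, curvatureEndo, curvatureEndo, h1.fderiv_eq, h1.eq_of_nhds]

end Congr

/-! ### From tensors on the manifold to the preferred chart -/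

section Chart

variable {E : Type*} [NormedAddCommGroup E] [NormedSpace ℝ E]
  {H : Type*} [TopologicalSpace H] (I : ModelWithCorners ℝ E H)
  {M : Type*} [TopologicalSpace M] [ChartedSpace H M] [IsManifold I 1 M]

/-- The tangent space at p is modelled on E through the preferred chart at p, so that chart has
identity derivative there and the pullbacks in the tensor definitions disappear. -/
theorem mfderiv_extChartAt_self (p : M) :
    mfderiv I 𝓘(ℝ, E) (extChartAt I p) p = ContinuousLinearMap.id ℝ E := by
  rw [(mdifferentiableAt_extChartAt (mem_chart_source H p)).mfderiv]
  have h : writtenInExtChartAt I 𝓘(ℝ, E) p (extChartAt I p)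
      =ᶠ[nhdsWithin (extChartAt I p p) (Set.range I)] id := by
    filter_upwards [extChartAt_target_mem_nhdsWithin p] with z hz
    exact (extChartAt I p).right_inv hz
  rw [h.fderivWithin_eq ((extChartAt I p).right_inv (mem_extChartAt_target p))]
  exact fderivWithin_id (I.uniqueDiffOn _ (extChartAt_target_subset_range p
    (mem_extChartAt_target p)))

theorem mfderivWithin_extChartAt_symm_self (p : M) :
    mfderivWithin 𝓘(ℝ, E) I (extChartAt I p).symm (Set.range I) (extChartAt I p p)
      = ContinuousLinearMap.id ℝ E := by
  have h := mfderiv_extChartAt_comp_mfderivWithin_extChartAt_symm' (I := I)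
    (mem_extChartAt_source (I := I) p)
  rw [mfderiv_extChartAt_self] at h
  exact h

variable (g : ∀ p : M, TangentSpace I p →L[ℝ] TangentSpace I p →L[ℝ] ℝ) (p : M)

theorem inChart_self : inChart I g p (extChartAt I p p) = g p := by
  have h : (g ((extChartAt I p).symm (extChartAt I p p)) : E →L[ℝ] E →L[ℝ] ℝ) = g p :=
    congr_arg (fun q : M => show E →L[ℝ] E →L[ℝ] ℝ from g q) (extChartAt_to_inv (I := I) p)
  rw [inChart, mfderivWithin_extChartAt_symm_self]
  exact h

theorem ricci_eq_localRicci [FiniteDimensional ℝ E] :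
    ricci I g p = localRicci (inChart I g p) (extChartAt I p p) := by
  rw [ricci, mfderiv_extChartAt_self]
  rfl

theorem hessian_eq_localHessian (f : M → ℝ) :
    hessian I g f p
      = localHessian (inChart I g p) (f ∘ (extChartAt I p).symm) (extChartAt I p p) := by
  rw [hessian, mfderiv_extChartAt_self]
  rfl

theorem traceAt_eq (β : E →L[ℝ] E →L[ℝ] ℝ) :
    traceAt I g p β = LinearMap.trace ℝ E
      ((inChart I g p (extChartAt I p p)).inverse.comp β : E →L[ℝ] E) := by
  rw [inChart_self]
  rfl

theorem scalarCurvature_eq [FiniteDimensional ℝ E] :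
    scalarCurvature I g p = LinearMap.trace ℝ E
      ((inChart I g p (extChartAt I p p)).inverse.comp
        (localRicci (inChart I g p) (extChartAt I p p)) : E →L[ℝ] E) := by
  rw [scalarCurvature, ricci_eq_localRicci]
  exact traceAt_eq I g p _

theorem laplacian_eq (f : M → ℝ) :
    laplacian I g f p = LinearMap.trace ℝ E
      ((inChart I g p (extChartAt I p p)).inverse.comp
        (localHessian (inChart I g p) (f ∘ (extChartAt I p).symm) (extChartAt I p p)) :
          E →L[ℝ] E) := by
  rw [laplacian, hessian_eq_localHessian]
  exact traceAt_eq I g p _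

end Chart

/-! ### Regularity of the metric on F in charts -/

section Riemannian

variable {E : Type*} [NormedAddCommGroup E] [NormedSpace ℝ E] [FiniteDimensional ℝ E]
  {F : Type*} [TopologicalSpace F] [ChartedSpace E F] [IsManifold 𝓘(ℝ, E) ∞ F]
  (gF : Bundle.ContMDiffRiemannianMetric 𝓘(ℝ, E) ∞ E (fun p : F => TangentSpace 𝓘(ℝ, E) p))
  {f : F → ℝ}

/-- The tangent map of the inverse chart carries constant fields to smooth sections along it;
pairing these with the smooth bundle metric gives smooth components. -/
theorem contDiffOn_inChart (p : F) :
    ContDiffOn ℝ ∞ (inChart 𝓘(ℝ, E) gF.inner p) (extChartAt 𝓘(ℝ, E) p).target := by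
  have hs : ContMDiffOn 𝓘(ℝ, E) 𝓘(ℝ, E) ∞ (extChartAt 𝓘(ℝ, E) p).symm
    (extChartAt 𝓘(ℝ, E) p).target := contMDiffOn_extChartAt_symm p
  have ho : IsOpen (extChartAt 𝓘(ℝ, E) p).target := isOpen_extChartAt_target p
  have ht := hs.contMDiffOn_tangentMapWithin (m := ∞) (by simp) ho.uniqueMDiffOn
  have hv (v : E) : ContMDiffOn 𝓘(ℝ, E) (𝓘(ℝ, E).prod 𝓘(ℝ, E)) ∞
      (fun y => Bundle.TotalSpace.mk' E (E := fun p : F => TangentSpace 𝓘(ℝ, E) p)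
        ((extChartAt 𝓘(ℝ, E) p).symm y)
        (mfderivWithin 𝓘(ℝ, E) 𝓘(ℝ, E) (extChartAt 𝓘(ℝ, E) p).symm
          (Set.range 𝓘(ℝ, E)) y v)) (extChartAt 𝓘(ℝ, E) p).target := by
    have hc : ContMDiff 𝓘(ℝ, E) 𝓘(ℝ, E).tangent ∞
        (fun y : E => (⟨y, v⟩ : TangentBundle 𝓘(ℝ, E) E)) :=
      contMDiff_vectorSpace_iff_contDiff (V := fun _ => v) |>.2 contDiff_const
    refine (ht.comp hc.contMDiffOn (fun y hy => hy)).congr fun y hy => ?_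
    rw [ModelWithCorners.range_eq_univ, mfderivWithin_univ]
    have e := mfderivWithin_of_isOpen (I := 𝓘(ℝ, E)) (I' := 𝓘(ℝ, E))
      (f := (extChartAt 𝓘(ℝ, E) p).symm) ho hy
    rw [← e]
    rfl
  refine contDiffOn_clm_apply.2 fun u => contDiffOn_clm_apply.2 fun v => ?_
  have h : ContMDiffOn 𝓘(ℝ, E) (𝓘(ℝ, E).prod 𝓘(ℝ, ℝ)) ∞
      (fun y => Bundle.TotalSpace.mk' ℝ (E := Bundle.Trivial F ℝ)
        ((extChartAt 𝓘(ℝ, E) p).symm y) (inChart 𝓘(ℝ, E) gF.inner p y u v))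
      (extChartAt 𝓘(ℝ, E) p).target :=
    ContMDiffOn.clm_bundle_apply₂ (F₁ := E) (F₂ := E) (gF.contMDiff.comp_contMDiffOn hs)
      (hv u) (hv v)
  rw [← contMDiffOn_iff_contDiffOn]
  exact fun y hy => (Bundle.contMDiffWithinAt_totalSpace.1 (h y hy)).2

theorem isStaticDatum_inChart (hf : ContMDiff 𝓘(ℝ, E) 𝓘(ℝ, ℝ) ∞ f) (hfpos : ∀ p, 0 < f p) (p : F) :
    IsStaticDatum (f ∘ (extChartAt 𝓘(ℝ, E) p).symm) (inChart 𝓘(ℝ, E) gF.inner p)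
      (extChartAt 𝓘(ℝ, E) p p) := by
  have hn : (extChartAt 𝓘(ℝ, E) p).target ∈ nhds (extChartAt 𝓘(ℝ, E) p p) :=
    extChartAt_target_mem_nhds p
  refine ⟨?_, ?_, .of_forall fun x => (hfpos _).ne', ?_, .of_forall fun x u v => gF.symm _ _ _⟩
  · have h : ContMDiffOn 𝓘(ℝ, E) 𝓘(ℝ, ℝ) ∞ (f ∘ (extChartAt 𝓘(ℝ, E) p).symm)
      (extChartAt 𝓘(ℝ, E) p).target := hf.comp_contMDiffOn (contMDiffOn_extChartAt_symm p)
    exact (h.contDiffOn.contDiffAt hn).of_le ENat.LEInfty.out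
  · exact ((contDiffOn_inChart gF p).contDiffAt hn).of_le ENat.LEInfty.out
  -- On the chart target the inverse chart has injective derivative, so the pulled-back form stays
  -- positive definite.
  · filter_upwards [hn] with y hy
    refine isInvertible_of_pos _ fun v hv => gF.pos _ _ fun h0 => hv ?_
    have hi := isInvertible_mfderivWithin_extChartAt_symm (I := 𝓘(ℝ, E)) (x := p) hy
    exact hi.injective (h0.trans (map_zero _).symm)

end Riemannian

/-! ### The static metric in product charts -/

section Static

variable {E : Type*} [NormedAddCommGroup E] [NormedSpace ℝ E]
  {F : Type*} [TopologicalSpace F] [ChartedSpace E F] [IsManifold 𝓘(ℝ, E) ∞ F]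
  {J : TopologicalSpace.Opens ℝ} (f : F → ℝ)
  (gF : ∀ p : F, TangentSpace 𝓘(ℝ, E) p →L[ℝ] TangentSpace 𝓘(ℝ, E) p →L[ℝ] ℝ)

theorem dt_comp_mfderivWithin (x : J × F) {z : ℝ × E}
    (hz : z ∈ (extChartAt (𝓘(ℝ, ℝ).prod 𝓘(ℝ, E)) x).target) :
    (dt J ((extChartAt (𝓘(ℝ, ℝ).prod 𝓘(ℝ, E)) x).symm z)).comp
      (mfderivWithin 𝓘(ℝ, ℝ × E) (𝓘(ℝ, ℝ).prod 𝓘(ℝ, E))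
        (extChartAt (𝓘(ℝ, ℝ).prod 𝓘(ℝ, E)) x).symm
        (Set.range (𝓘(ℝ, ℝ).prod 𝓘(ℝ, E))) z) = ContinuousLinearMap.fst ℝ ℝ E := by
  have hs : MDifferentiableAt (𝓘(ℝ, ℝ).prod 𝓘(ℝ, E)) 𝓘(ℝ, ℝ) (fun y : J × F => (y.1 : ℝ))
      ((extChartAt (𝓘(ℝ, ℝ).prod 𝓘(ℝ, E)) x).symm z) :=
    ((contMDiff_subtype_val (n := 1)).comp contMDiff_fst).mdifferentiable (by norm_num) _
  have hU : UniqueMDiffWithinAt 𝓘(ℝ, ℝ × E) (Set.range (𝓘(ℝ, ℝ).prod 𝓘(ℝ, E))) z :=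
    (𝓘(ℝ, ℝ).prod 𝓘(ℝ, E)).uniqueMDiffOn _ (extChartAt_target_subset_range x hz)
  have hc := mfderiv_comp_mfderivWithin z hs (mdifferentiableWithinAt_extChartAt_symm hz) hU
  refine hc.symm.trans ?_
  -- The chart of an open subset of the line is the inclusion, so t is the first chart coordinate.
  have he : (fun y : J × F => (y.1 : ℝ)) ∘ (extChartAt (𝓘(ℝ, ℝ).prod 𝓘(ℝ, E)) x).symm
      =ᶠ[nhds z] Prod.fst := by
    filter_upwards [(isOpen_extChartAt_target x).mem_nhds hz] with y hy
    exact congr_arg Prod.fst ((extChartAt (𝓘(ℝ, ℝ).prod 𝓘(ℝ, E)) x).right_inv hy)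
  rw [ModelWithCorners.range_eq_univ, mfderivWithin_univ, he.mfderiv_eq, mfderiv_eq_fderiv,
    fderiv_fst]

theorem mfderiv_snd_comp_mfderivWithin (x : J × F) {z : ℝ × E}
    (hz : z ∈ (extChartAt (𝓘(ℝ, ℝ).prod 𝓘(ℝ, E)) x).target) :
    (mfderiv (𝓘(ℝ, ℝ).prod 𝓘(ℝ, E)) 𝓘(ℝ, E) (Prod.snd : J × F → F)
        ((extChartAt (𝓘(ℝ, ℝ).prod 𝓘(ℝ, E)) x).symm z)).comp
      (mfderivWithin 𝓘(ℝ, ℝ × E) (𝓘(ℝ, ℝ).prod 𝓘(ℝ, E))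
        (extChartAt (𝓘(ℝ, ℝ).prod 𝓘(ℝ, E)) x).symm
        (Set.range (𝓘(ℝ, ℝ).prod 𝓘(ℝ, E))) z)
      = (mfderivWithin 𝓘(ℝ, E) 𝓘(ℝ, E) (extChartAt 𝓘(ℝ, E) x.2).symm
          (Set.range 𝓘(ℝ, E)) z.2 : E →L[ℝ] E).comp (ContinuousLinearMap.snd ℝ ℝ E) := by
  have hU : UniqueMDiffWithinAt 𝓘(ℝ, ℝ × E) (Set.range (𝓘(ℝ, ℝ).prod 𝓘(ℝ, E))) z :=
    (𝓘(ℝ, ℝ).prod 𝓘(ℝ, E)).uniqueMDiffOn _ (extChartAt_target_subset_range x hz)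
  have hc := mfderiv_comp_mfderivWithin z
    (mdifferentiableAt_snd (I := 𝓘(ℝ, ℝ)) (I' := 𝓘(ℝ, E))
      (x := (extChartAt (𝓘(ℝ, ℝ).prod 𝓘(ℝ, E)) x).symm z))
    (mdifferentiableWithinAt_extChartAt_symm hz) hU
  refine hc.symm.trans ?_
  have hz2 : z.2 ∈ (extChartAt 𝓘(ℝ, E) x.2).target := by
    rw [extChartAt_prod, PartialEquiv.prod_target] at hz
    exact hz.2
  have h1 : MDifferentiableAt 𝓘(ℝ, E) 𝓘(ℝ, E) (extChartAt 𝓘(ℝ, E) x.2).symm z.2 := by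
    have := mdifferentiableWithinAt_extChartAt_symm (I := 𝓘(ℝ, E)) hz2
    rwa [ModelWithCorners.range_eq_univ, mdifferentiableWithinAt_univ] at this
  have h2 : MDifferentiableAt 𝓘(ℝ, ℝ × E) 𝓘(ℝ, E) (Prod.snd : ℝ × E → E) z :=
    differentiableAt_snd.mdifferentiableAt
  have h3 : (Prod.snd : J × F → F) ∘ (extChartAt (𝓘(ℝ, ℝ).prod 𝓘(ℝ, E)) x).symm
      = (extChartAt 𝓘(ℝ, E) x.2).symm ∘ Prod.snd := by
    rw [extChartAt_prod]
    rfl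
  rw [ModelWithCorners.range_eq_univ, ModelWithCorners.range_eq_univ, mfderivWithin_univ,
    mfderivWithin_univ, h3, mfderiv_comp z h1 h2, mfderiv_eq_fderiv, fderiv_snd]
  rfl

/-- By the two chain-rule computations above, dt becomes the first projection and the differential
of the projection to F factors through the chart of F. -/
theorem inChart_staticMetric (x : J × F) :
    inChart (𝓘(ℝ, ℝ).prod 𝓘(ℝ, E)) (staticMetric J f gF) x
      =ᶠ[nhds (extChartAt (𝓘(ℝ, ℝ).prod 𝓘(ℝ, E)) x x)]
        localStatic (f ∘ (extChartAt 𝓘(ℝ, E) x.2).symm) (inChart 𝓘(ℝ, E) gF x.2) := by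
  filter_upwards [extChartAt_target_mem_nhds x] with z hz
  have h1 (u : ℝ × E) := congr($(dt_comp_mfderivWithin x hz) u)
  have h2 (u : ℝ × E) := congr($(mfderiv_snd_comp_mfderivWithin x hz) u)
  refine ContinuousLinearMap.ext fun u => ContinuousLinearMap.ext fun v => ?_
  have h3 := congr_arg₂ (fun a b : ℝ => -(f ((extChartAt 𝓘(ℝ, E) x.2).symm z.2) ^ 2 * (a * b)))
    (h1 u) (h1 v)
  have h4 := congr_arg₂ (fun a b : E => gF ((extChartAt 𝓘(ℝ, E) x.2).symm z.2) a b) (h2 u) (h2 v)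
  exact congr_arg₂ (· + ·) h3 h4

theorem staticMetric_apply (x : J × F) (w : ℝ × E) :
    staticMetric J f gF x w w
      = -(f x.2 ^ 2 * (w.1 * w.1)) + (gF x.2 : E →L[ℝ] E →L[ℝ] ℝ) w.2 w.2 := by
  have h := (inChart_staticMetric f gF x).self_of_nhds
  rw [inChart_self] at h
  have h1 := congr($h w w)
  have h2 := inChart_self 𝓘(ℝ, E) gF x.2
  have h3 := congr($h2 w.2 w.2)
  refine h1.trans ?_
  rw [localStatic_apply]
  refine congr_arg₂ (· + ·) ?_ h3
  have h4 : (f ∘ (extChartAt 𝓘(ℝ, E) x.2).symm) (extChartAt 𝓘(ℝ, E) x.2 x.2) = f x.2 :=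
    congr_arg f (extChartAt_to_inv x.2)
  exact congr_arg (fun a => -(a ^ 2 * (w.1 * w.1))) h4

end Static

/-! ### The energy-momentum identity on the manifold -/

section Static

variable {E : Type*} [NormedAddCommGroup E] [NormedSpace ℝ E] [FiniteDimensional ℝ E]
  {F : Type*} [TopologicalSpace F] [ChartedSpace E F] [IsManifold 𝓘(ℝ, E) ∞ F]
  {J : TopologicalSpace.Opens ℝ}
  (gF : Bundle.ContMDiffRiemannianMetric 𝓘(ℝ, E) ∞ E (fun p : F => TangentSpace 𝓘(ℝ, E) p))
  {f : F → ℝ}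

/-- The energy-momentum tensor of a standard static space-time. -/
theorem energyMomentum_staticMetric (hf : ContMDiff 𝓘(ℝ, E) 𝓘(ℝ, ℝ) ∞ f) (hfpos : ∀ p, 0 < f p)
    (x : J × F) (w : ℝ × E) :
    8 * Real.pi * energyMomentum (𝓘(ℝ, ℝ).prod 𝓘(ℝ, E)) (staticMetric J f gF.inner) x w w
      = -((f x.2)⁻¹ * (adjointScalar 𝓘(ℝ, E) gF.inner f x.2 : E →L[ℝ] E →L[ℝ] ℝ) w.2 w.2)
        - 1 / 2 * scalarCurvature 𝓘(ℝ, E) gF.inner x.2 * staticMetric J f gF.inner x w w := by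
  have hG := inChart_staticMetric f gF.inner x
  have key := IsStaticDatum.einstein_localStatic
    (z := extChartAt (𝓘(ℝ, ℝ).prod 𝓘(ℝ, E)) x x) (isStaticDatum_inChart gF hf hfpos x.2) w
  have hφ : (f ∘ (extChartAt 𝓘(ℝ, E) x.2).symm)
      (extChartAt (𝓘(ℝ, ℝ).prod 𝓘(ℝ, E)) x x).2 = f x.2 :=
    congr_arg f (extChartAt_to_inv x.2)
  have hz : (extChartAt (𝓘(ℝ, ℝ).prod 𝓘(ℝ, E)) x x).2 = extChartAt 𝓘(ℝ, E) x.2 x.2 := rfl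
  -- Each local expression is recognised as the corresponding tensor at x or at its projection to F.
  rw [← localRicci_congr hG, ← hG.eq_of_nhds, ← scalarCurvature_eq, hφ, hz,
    ← scalarCurvature_eq, ← laplacian_eq, inChart_self, inChart_self, ← ricci_eq_localRicci,
    ← ricci_eq_localRicci, ← hessian_eq_localHessian] at key
  have hT : 8 * Real.pi *
      energyMomentum (𝓘(ℝ, ℝ).prod 𝓘(ℝ, E)) (staticMetric J f gF.inner) x w w
      = ricci (𝓘(ℝ, ℝ).prod 𝓘(ℝ, E)) (staticMetric J f gF.inner) x w w
        - 1 / 2 * scalarCurvature (𝓘(ℝ, ℝ).prod 𝓘(ℝ, E)) (staticMetric J f gF.inner) x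
          * staticMetric J f gF.inner x w w := by
    change 8 * Real.pi * (1 / (8 * Real.pi) * _) = _
    rw [← mul_assoc, mul_one_div_cancel (by positivity), one_mul]
    rfl
  exact hT.trans key

end Static

end PseudoRiem

end

/-! ### Energy conditions -/

theorem mainTheorem8
    {E : Type*} [NormedAddCommGroup E] [NormedSpace ℝ E] [FiniteDimensional ℝ E]
    {F : Type*} [TopologicalSpace F] [ChartedSpace E F] [IsManifold 𝓘(ℝ, E) ∞ F]
    (gF : Bundle.ContMDiffRiemannianMetric 𝓘(ℝ, E) ∞ E (fun p : F => TangentSpace 𝓘(ℝ, E) p))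
    (f : F → ℝ) (hf : ContMDiff 𝓘(ℝ, E) 𝓘(ℝ, ℝ) ∞ f) (hfpos : ∀ p, 0 < f p)
    (t₁ t₂ : EReal) (ht : t₁ < t₂)
    (g : ∀ x : PseudoRiem.openInterval t₁ t₂ × F,
      TangentSpace (𝓘(ℝ, ℝ).prod 𝓘(ℝ, E)) x →L[ℝ]
        TangentSpace (𝓘(ℝ, ℝ).prod 𝓘(ℝ, E)) x →L[ℝ] ℝ)
    (hg : g = PseudoRiem.staticMetric (PseudoRiem.openInterval t₁ t₂) f gF.inner) :
    ((∀ p v, PseudoRiem.adjointScalar 𝓘(ℝ, E) gF.inner f p v v ≤ 0) →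
      (∀ p, 0 ≤ PseudoRiem.scalarCurvature 𝓘(ℝ, E) gF.inner p) →
      ∀ x w, PseudoRiem.IsCausal (𝓘(ℝ, ℝ).prod 𝓘(ℝ, E)) g x w →
        0 ≤ PseudoRiem.energyMomentum (𝓘(ℝ, ℝ).prod 𝓘(ℝ, E)) g x w w) ∧
    ((∀ p v, 0 ≤ PseudoRiem.adjointScalar 𝓘(ℝ, E) gF.inner f p v v) →
      (∀ p, PseudoRiem.scalarCurvature 𝓘(ℝ, E) gF.inner p ≤ 0) →
      ∀ x w, PseudoRiem.IsCausal (𝓘(ℝ, ℝ).prod 𝓘(ℝ, E)) g x w →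
        PseudoRiem.energyMomentum (𝓘(ℝ, ℝ).prod 𝓘(ℝ, E)) g x w w ≤ 0) ∧
    ((∀ p v, PseudoRiem.adjointScalar 𝓘(ℝ, E) gF.inner f p v v = 0) →
      (∀ x w, 8 * Real.pi * PseudoRiem.energyMomentum (𝓘(ℝ, ℝ).prod 𝓘(ℝ, E)) g x w w =
        -(1 / 2) * PseudoRiem.scalarCurvature 𝓘(ℝ, E) gF.inner x.2 * g x w w) ∧
      ((∀ x w, PseudoRiem.IsCausal (𝓘(ℝ, ℝ).prod 𝓘(ℝ, E)) g x w →
          0 ≤ PseudoRiem.energyMomentum (𝓘(ℝ, ℝ).prod 𝓘(ℝ, E)) g x w w) ↔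
        ∀ p, 0 ≤ PseudoRiem.scalarCurvature 𝓘(ℝ, E) gF.inner p)) := by

  subst hg
  have hT := PseudoRiem.energyMomentum_staticMetric (J := PseudoRiem.openInterval t₁ t₂) gF hf hfpos
  refine ⟨fun hL hτ x w hw => ?_, fun hL hτ x w hw => ?_, fun hL => ?_⟩
  · have h1 := mul_nonneg (inv_pos.2 (hfpos x.2)).le (neg_nonneg.2 (hL x.2 w.2))
    have h2 := mul_nonneg (hτ x.2) (neg_nonneg.2 hw.2)
    refine nonneg_of_mul_nonneg_right ?_ (by positivity : 0 < 8 * Real.pi)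
    rw [hT x w]
    linarith
  · have h1 := mul_nonneg (inv_pos.2 (hfpos x.2)).le (hL x.2 w.2)
    have h2 := mul_nonneg (neg_nonneg.2 (hτ x.2)) (neg_nonneg.2 hw.2)
    refine nonpos_of_mul_nonpos_right ?_ (by positivity : 0 < 8 * Real.pi)
    rw [hT x w]
    linarith
  · have hE (x : PseudoRiem.openInterval t₁ t₂ × F) (w : ℝ × E) :
        8 * Real.pi * PseudoRiem.energyMomentum (𝓘(ℝ, ℝ).prod 𝓘(ℝ, E))
          (PseudoRiem.staticMetric (PseudoRiem.openInterval t₁ t₂) f gF.inner) x w w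
          = -(1 / 2) * PseudoRiem.scalarCurvature 𝓘(ℝ, E) gF.inner x.2
            * PseudoRiem.staticMetric (PseudoRiem.openInterval t₁ t₂) f gF.inner x w w := by
      rw [hT x w]
      have h0 := congr_arg (fun a : ℝ => (f x.2)⁻¹ * a) (hL x.2 w.2)
      linarith
    refine ⟨hE, fun h p => ?_, fun hτ x w hw => ?_⟩
    -- A nonempty interval provides a point over p; the test vector there is ∂_t = (1, 0).
    · obtain ⟨t, ht1, ht2⟩ := EReal.lt_iff_exists_real_btwn.1 ht
      let x : PseudoRiem.openInterval t₁ t₂ × F := (⟨t, ht1, ht2⟩, p)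
      have hfp := hfpos p
      have hg : PseudoRiem.staticMetric (PseudoRiem.openInterval t₁ t₂) f gF.inner x
          ((1, 0) : ℝ × E) ((1, 0) : ℝ × E) = -f p ^ 2 := by
        rw [PseudoRiem.staticMetric_apply]
        have h0 : (gF.inner p : E →L[ℝ] E →L[ℝ] ℝ) 0 0 = 0 := map_zero _
        change -(f p ^ 2 * (1 * 1)) + (gF.inner p : E →L[ℝ] E →L[ℝ] ℝ) 0 0 = _
        rw [h0]
        ring
      have hc := h x ((1, 0) : ℝ × E) ⟨fun h0 => one_ne_zero (congr_arg Prod.fst h0 : (1 : ℝ) = 0), by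
        rw [hg]
        nlinarith⟩
      have hm := mul_nonneg (by positivity : 0 ≤ 8 * Real.pi) hc
      rw [hE x, hg] at hm
      have hm' : 0 ≤ PseudoRiem.scalarCurvature 𝓘(ℝ, E) gF.inner p * (1 / 2 * f p ^ 2) := by
        linarith
      exact nonneg_of_mul_nonneg_left hm' (by positivity)
    · have h2 := mul_nonneg (hτ x.2) (neg_nonneg.2 hw.2)
      refine nonneg_of_mul_nonneg_right ?_ (by positivity : 0 < 8 * Real.pi)
      rw [hE x w]
      linarith
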